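/- Conventions. A finite piecewise linear function (FPLF) $f:\mathbb{R}^n\to\mathbb{R}^m$ is a function that is affine on each of finitely many closed convex polyhedra covering $\mathbb{R}^n$ (hence continuous). For $\Omega\subseteq\mathbb{R}^n$, the Jacobian rank $\mathrm{Rank}_J(f;\Omega)$ is the maximal rank of $Jf(x)$ over the $x\in\Omega$ at which $f$ is differentiable, and the bottleneck rank $\mathrm{Rank}_{BN}(f;\Omega)$ is the smallest $k\in\mathbb{N}$ such that $f=h\circ g$ on $\Omega$ for some FPLFs $g:\mathbb{R}^n\to\mathbb{R}^k$ and $h:\mathbb{R}^k\to\mathbb{R}^m$. For $a\in(-1,1)$ let $\sigma_a(t)=t$ for $t\ge 0$ and $\sigma_a(t)=at$ for $t<0$. A network of depth $L\ge1$ with parameters $\mathbf{W}=(W_1,b_1,\dots,W_L,b_L)$ and any finite widths $n=n_0,n_1,\dots,n_L=m$ has the network function $f_{\mathbf{W}}(x)=\tilde\alpha_L(x)$, where $\alpha_0(x)=x$, $\tilde\alpha_\ell=W_\ell\alpha_{\ell-1}+b_\ell$, $\alpha_\ell=\sigma_a(\tilde\alpha_\ell)$ entrywise; $\|\mathbf{W}\|^2$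 is the sum of the squares of all weights and biases. The representation cost $R(f;\Omega,\sigma_a,L)\in[0,\infty]$ is the infimum of $\|\mathbf{W}\|^2$ over all depth-$L$ networks with $f_{\mathbf{W}}=f$ on $\Omega$. Norms on $\mathbb{R}^n$ and $\mathbb{R}^m$ are Euclidean, $\mathrm{TSP}(y_1,\dots,y_N)=\min_{\pi\in S_N}\sum_{i=1}^{N-1}\|y_{\pi(i+1)}-y_{\pi(i)}\|$ is the length of the shortest path through all the points, $\mathrm{diam}$ is the diameter of a set of points, and $\mathrm{TSP}(y_1,\dots,y_N)/\mathrm{diam}(x_1,\dots,x_N)$ is read as $0$ if all $x_i$ coincide. Theorem. (1) Let $N\ge1$, $x_1,\dots,x_N\in\mathbb{R}^n$, let $\Omega\subseteq\mathbb{R}^n$ contain the convex hull of $x_1,\dots,x_N$, and let $f$ satisfy $\mathrm{Rank}_{BN}(f;\Omega)=1$ and $f(x_i)=y_i$ for all $i$. If $\Omega$ is contained in the closure of its interior, then there is a point $z\in\Omega$ at which $f$ is differentiable and $$\|Jf(z)\|_{op}\ \ge\ \frac{\mathrm{TSP}(y_1,\dots,y_N)}{\mathrm{diam}(x_1,\dots,x_N)}.$$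 Moreover (for every such $\Omega$, whether or not it is contained in the closure of its interior), for all $L\ge1$ and $a\in(-1,1)$, every depth-$L$ network with $f_{\mathbf{W}}=f$ on $\Omega$ satisfies $$\|\mathbf{W}\|^2\ \ge\ L\left(\frac{\mathrm{TSP}(y_1,\dots,y_N)}{\mathrm{diam}(x_1,\dots,x_N)}\right)^{2/L},\qquad\text{so that}\qquad \frac1L R(f;\Omega,\sigma_a,L)\ \ge\ \left(\frac{\mathrm{TSP}(y_1,\dots,y_N)}{\mathrm{diam}(x_1,\dots,x_N)}\right)^{2/L}.$$ (2) Let $\Omega\subset\mathbb{R}^n$ be bounded and contained in the closure of its interior, let $f^*:\mathbb{R}^n\to\mathbb{R}^m$ be an FPLF with $\mathrm{Rank}_J(f^*;\Omega)=k\ge1$, and let $p$ be a probability measure concentrated on $\Omega$, with support $\overline{\Omega}$, whose restriction to any open set of positive mass is not singular with respect to Lebesgue measure (for example, $p$ has a density). Then for every $\epsilon>0$ there are $c_\epsilon>0$ and $N_\epsilon\in\mathbb{N}$ such that for every $N\ge N_\epsilon$, if $x_1,\dots,x_N$ are sampled i.i.d. from $p$ and $y_i=f^*(x_i)$, then with probability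 at least $1-\epsilon$ the following holds for all $L\ge1$ and $a\in(-1,1)$: $$\left(\frac{\mathrm{TSP}(y_1,\dots,y_N)}{\mathrm{diam}(x_1,\dots,x_N)}\right)^{2/L}>c_\epsilon N^{\frac2L\left(1-\frac1k\right)},$$ and every $\hat f$ with $\mathrm{Rank}_{BN}(\hat f;\Omega)=1$ and $\hat f(x_i)=y_i$ for all $i$ satisfies $$\frac1L R(\hat f;\Omega,\sigma_a,L)\ >\ c_\epsilon N^{\frac2L\left(1-\frac1k\right)}.$$ -/

import Mathlib

open Set MeasureTheory
open scoped ENNReal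

noncomputable section

/-- A (closed, convex) polyhedron of `ℝⁿ`: a finite intersection of closed half-spaces. -/
def IsPolyhedron {n : ℕ} (P : Set (EuclideanSpace ℝ (Fin n))) : Prop :=
  ∃ (r : ℕ) (v : Fin r → EuclideanSpace ℝ (Fin n)) (t : Fin r → ℝ),
    P = {x | ∀ i, inner ℝ (v i) x ≤ t i}

/-- Finite piecewise linear functions (FPLF): `ℝⁿ` is covered by finitely many polyhedra, on each
of which `f` is affine.  Since the polyhedra are closed, such an `f` is continuous. -/
def IsFPLF {n m : ℕ} (f : EuclideanSpace ℝ (Fin n) → EuclideanSpace ℝ (Fin m)) : Prop :=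
  ∃ (r : ℕ) (P : Fin r → Set (EuclideanSpace ℝ (Fin n))),
    (∀ j, IsPolyhedron (P j)) ∧ (⋃ j, P j) = univ ∧
      ∀ j, ∃ A : EuclideanSpace ℝ (Fin n) →ᵃ[ℝ] EuclideanSpace ℝ (Fin m), EqOn f A (P j)

/-- The Jacobian rank of `f` on `Ω`: the maximal rank of the Jacobian over the points of `Ω` at
which `f` is differentiable (these ranks are bounded by `n`, so the supremum is a maximum). -/
def rankJ {n m : ℕ} (f : EuclideanSpace ℝ (Fin n) → EuclideanSpace ℝ (Fin m))
    (Ω : Set (EuclideanSpace ℝ (Fin n))) : ℕ :=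
  sSup {r : ℕ | ∃ x ∈ Ω, DifferentiableAt ℝ f x ∧
    Module.finrank ℝ (LinearMap.range (fderiv ℝ f x).toLinearMap) = r}

/-- The bottleneck rank of `f` on `Ω`: the smallest inner dimension `k` of a factorization
`f = h ∘ g` on `Ω` through FPLFs `g : ℝⁿ → ℝᵏ` and `h : ℝᵏ → ℝᵐ`. -/
def rankBN {n m : ℕ} (f : EuclideanSpace ℝ (Fin n) → EuclideanSpace ℝ (Fin m))
    (Ω : Set (EuclideanSpace ℝ (Fin n))) : ℕ :=
  sInf {k : ℕ | ∃ (g : EuclideanSpace ℝ (Fin n) → EuclideanSpace ℝ (Fin k))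
    (h : EuclideanSpace ℝ (Fin k) → EuclideanSpace ℝ (Fin m)),
      IsFPLF g ∧ IsFPLF h ∧ EqOn f (h ∘ g) Ω}

/-- The length of the shortest path through all the points `y₁, …, y_N`: the minimum, over the
orders in which the points are visited, of the length of the corresponding polygonal path. -/
def tsp {m N : ℕ} (y : Fin N → EuclideanSpace ℝ (Fin m)) : ℝ :=
  ⨅ π : Equiv.Perm (Fin N), ∑ i : Fin (N - 1),
    dist (y (π ⟨i, by omega⟩)) (y (π ⟨i + 1, by omega⟩))

/-- The homogeneous nonlinearity `σ_a`: `x` for `x ≥ 0` and `a x` for `x < 0`. -/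
def sigmaA (a x : ℝ) : ℝ := if 0 ≤ x then x else a * x

/-- The parameters `(W₁, b₁, …, W_L, b_L)` of a fully connected network of depth `L`, with input
dimension `n`, output dimension `m` and arbitrary hidden widths.  `output W b` is a network of
depth `1`; `hidden W b w` puts a first layer of width `h` in front of the network `w`. -/
inductive Network : (L n m : ℕ) → Type
  | output {n m : ℕ} (W : Matrix (Fin m) (Fin n) ℝ) (b : Fin m → ℝ) : Network 1 n m
  | hidden {L n h m : ℕ} (W : Matrix (Fin h) (Fin n) ℝ) (b : Fin h → ℝ)
      (rest : Network L h m) : Network (L + 1) n m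

namespace Network

/-- The network function `f_w` for the nonlinearity `σ`; no nonlinearity is applied after the last
affine map. -/
def eval (σ : ℝ → ℝ) : {L n m : ℕ} → Network L n m →
    EuclideanSpace ℝ (Fin n) → EuclideanSpace ℝ (Fin m)
  | _, _, _, output W b, x => WithLp.toLp 2 (W.mulVec x.ofLp + b)
  | _, _, _, hidden W b rest, x =>
      eval σ rest (WithLp.toLp 2 fun i => σ ((W.mulVec x.ofLp + b) i))

/-- The squared `L₂`-norm `‖w‖²` of the vector of all parameters (weights and biases). -/
def normSq : {L n m : ℕ} → Network L n m → ℝ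
  | _, _, _, output W b => (∑ i, ∑ j, W i j ^ 2) + ∑ i, b i ^ 2
  | _, _, _, hidden W b rest => (∑ i, ∑ j, W i j ^ 2) + (∑ i, b i ^ 2) + normSq rest

end Network

/-- The representation cost `R(f; Ω, σ, L)`: the least `‖w‖²` over the networks of depth `L`, of
any widths, whose network function equals `f` on `Ω`; it is `∞` if there are none. -/
def reprCost {n m : ℕ} (f : EuclideanSpace ℝ (Fin n) → EuclideanSpace ℝ (Fin m))
    (Ω : Set (EuclideanSpace ℝ (Fin n))) (σ : ℝ → ℝ) (L : ℕ) : ℝ≥0∞ :=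
  ⨅ (w : Network L n m) (_ : EqOn (w.eval σ) f Ω), ENNReal.ofReal w.normSq

end

/-!
A function `f = h ∘ g` of bottleneck rank one factors through the real line. On the segment joining
a minimum of `g` over the data points to a maximum, the intermediate value theorem makes `g`, hence
`f`, pass through the values at all the data points in the order of `g`. So `f` traces a path through
all the labels along a segment no longer than the diameter of the inputs, and any Lipschitz constant
of `f` on this segment is at least the ratio of the shortest path to the diameter
(`exists_tsp_div_diam_le`). Two Lipschitz constants are used:

* for a network, the product of the Frobenius norms of the weights, which the inequality between the
  arithmetic and geometric means relates to the parameter norm (`Network.exists_lipschitz`,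
  `mul_prod_sqrt_rpow_le_sum`);
* the largest operator norm among the affine pieces of `f` whose interior meets the interior of `Ω`.
  These finitely many closed pieces cover `Ω` if `Ω ⊆ closure (interior Ω)`, and a Lipschitz bound
  on each of them holds along the whole segment (`exists_mem_closure_interior_inter`,
  `dist_le_of_finite_closed_cover`).

For random data, the true function is affine of rank `k` on some ball inside `Ω`, and the sampling
measure is bounded by a multiple of Lebesgue measure on a set `E` of positive mass `q` in this ball.
So a sample in `E` has its label within `r` of a given point with probability `O(r ^ k)`
(`IsFPLF.exists_small_ball`). With `r` a small multiple of `N ^ (-1 / k)`, the expected number of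
pairs with labels closer than `r` is a small multiple of `N`. By Markov's inequality few pairs are
close and by Chebyshev's inequality at least `q * N / 2` samples lie in `E`; then every path through
the labels has order `N` edges of length at least `r`, hence length of order `N ^ (1 - 1 / k)`
(`mul_card_sub_le_tsp`). As `Ω` need not be convex, the bound on the representation cost applies the
deterministic part to the samples in `E` only, whose convex hull lies in the ball.
-/

open Filter Topology

/-! ### Piecewise affine maps -/

section PiecewiseAffine

variable {E F G : Type*} [NormedAddCommGroup E] [NormedSpace ℝ E]
  [NormedAddCommGroup F] [NormedSpace ℝ F] [NormedAddCommGroup G] [NormedSpace ℝ G]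

/-- A map which is affine on each member of a finite closed cover of the space. Unlike for an FPLF,
the members need not be polyhedra: this is all that the arguments below use, and it makes stability
under composition immediate. -/
def IsPiecewiseAffine (f : E → F) : Prop :=
  ∃ (ι : Type) (_ : Finite ι) (C : ι → Set E) (A : ι → E →ᵃ[ℝ] F),
    (∀ j, IsClosed (C j)) ∧ (⋃ j, C j) = univ ∧ ∀ j, EqOn f (A j) (C j)

lemma IsPiecewiseAffine.continuous [FiniteDimensional ℝ E] {f : E → F}
    (hf : IsPiecewiseAffine f) : Continuous f := by
  obtain ⟨ι, _, C, A, hC, hcov, hA⟩ := hf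
  exact (locallyFinite_of_finite C).continuous hcov hC fun j =>
    ((A j).continuous_of_finiteDimensional.continuousOn).congr (hA j)

lemma IsPiecewiseAffine.comp [FiniteDimensional ℝ E] {h : F → G} {g : E → F}
    (hh : IsPiecewiseAffine h) (hg : IsPiecewiseAffine g) : IsPiecewiseAffine (h ∘ g) := by
  have hgc := hg.continuous
  obtain ⟨ι, _, C, A, hC, hcov, hA⟩ := hg
  obtain ⟨κ, _, D, B, hD, hcov', hB⟩ := hh
  refine ⟨ι × κ, inferInstance, fun j => C j.1 ∩ g ⁻¹' D j.2, fun j => (B j.2).comp (A j.1),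
    fun j => (hC _).inter ((hD _).preimage hgc), ?_, ?_⟩
  · refine eq_univ_of_forall fun x => ?_
    obtain ⟨i, hi⟩ := mem_iUnion.1 (hcov.symm ▸ mem_univ x)
    obtain ⟨k, hk⟩ := mem_iUnion.1 (hcov'.symm ▸ mem_univ (g x))
    exact mem_iUnion.2 ⟨(i, k), hi, hk⟩
  · rintro ⟨i, k⟩ x ⟨hx, hx'⟩
    have h1 : g x = A i x := hA i hx
    have h2 : h (g x) = B k (g x) := hB k hx'
    simp [← h1, h2]

/-- A finite closed cover covers a set contained in the closure of its interior already with those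
members whose interior meets the interior of the set, because frontiers are nowhere dense. -/
lemma exists_mem_closure_interior_inter {X ι : Type*} [TopologicalSpace X] [Finite ι]
    {C : ι → Set X} (hC : ∀ j, IsClosed (C j)) (hcov : (⋃ j, C j) = univ)
    {Ω : Set X} (hΩ : Ω ⊆ closure (interior Ω)) {z : X} (hz : z ∈ Ω) :
    ∃ j, z ∈ closure (interior (C j) ∩ interior Ω) := by
  have hdense : Dense (⋃ j, interior (C j)) := by
    have h : ∀ j ∈ (univ : Set ι), IsOpen (frontier (C j))ᶜ ∧ Dense (frontier (C j))ᶜ :=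
      fun j _ => ⟨isClosed_frontier.isOpen_compl,
        interior_eq_empty_iff_dense_compl.1 (interior_frontier (hC j))⟩
    have h2 : Dense (⋂ j ∈ (univ : Set ι), (frontier (C j))ᶜ) := by
      refine (Set.finite_univ (α := ι)).induction_on_subset
        (motive := fun s _ => Dense (⋂ j ∈ s, (frontier (C j))ᶜ)) _ (by simp) ?_
      intro a s _ _ _ hs
      rw [biInter_insert]
      exact (h a (mem_univ _)).2.inter_of_isOpen_left hs (h a (mem_univ _)).1
    refine h2.mono fun x hx => ?_
    obtain ⟨j, hj⟩ := mem_iUnion.1 (hcov.symm ▸ mem_univ x)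
    refine mem_iUnion.2 ⟨j, ?_⟩
    by_contra hn
    exact (mem_iInter₂.1 hx j (mem_univ _)) ⟨subset_closure hj, hn⟩
  have h3 : z ∈ closure (⋃ j, (interior (C j) ∩ interior Ω)) := by
    rw [← iUnion_inter, inter_comm]
    exact closure_minimal (hdense.open_subset_closure_inter isOpen_interior) isClosed_closure
      (hΩ hz)
  rw [closure_iUnion_of_finite] at h3
  exact mem_iUnion.1 h3

lemma AffineMap.hasFDerivAt_of_finiteDimensional [FiniteDimensional ℝ E] (A : E →ᵃ[ℝ] F) (z : E) :
    HasFDerivAt A (LinearMap.toContinuousLinearMap A.linear) z := by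
  rw [AffineMap.decomp A]
  exact (LinearMap.toContinuousLinearMap A.linear).hasFDerivAt.add_const _

lemma AffineMap.dist_le_of_finiteDimensional [FiniteDimensional ℝ E] (A : E →ᵃ[ℝ] F) (x y : E) :
    dist (A x) (A y) ≤ ‖LinearMap.toContinuousLinearMap A.linear‖ * dist x y := by
  rw [dist_eq_norm, dist_eq_norm, ← vsub_eq_sub, ← A.linearMap_vsub]
  exact (LinearMap.toContinuousLinearMap A.linear).le_opNorm (x - y)

/-- A Lipschitz bound that holds on each member of a finite closed cover of an interval holds on
the interval: from every point some member of the cover accumulates at it from the right, so the right slopes are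
frequently at most `K`. -/
lemma dist_le_of_finite_closed_cover {ι V : Type*} [Finite ι] [NormedAddCommGroup V] {u : ℝ → V}
    (hu : Continuous u) {D : ι → Set ℝ} (hD : ∀ j, IsClosed (D j)) {a b K : ℝ} (hcov : Icc a b ⊆ ⋃ j, D j)
    (hK : ∀ j, ∀ s ∈ D j, ∀ t ∈ D j, dist (u s) (u t) ≤ K * |s - t|) (hab : a ≤ b) :
    dist (u a) (u b) ≤ K * (b - a) := by
  refine le_of_forall_pos_le_add fun ε hε => ?_
  obtain ⟨η, hη, hηε⟩ : ∃ η > 0, η * (b - a) ≤ ε := by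
    refine ⟨ε / (b - a + 1), by have := sub_nonneg.2 hab; positivity, ?_⟩
    have := sub_nonneg.2 hab
    rw [div_mul_eq_mul_div, div_le_iff₀ (by positivity)]
    nlinarith
  have key := image_norm_le_of_liminf_right_slope_norm_lt_deriv_boundary
    (f := fun t => u t - u a) (f' := fun _ => K) (a := a) (b := b)
    (B := fun t => (K + η) * (t - a)) (B' := fun _ => K + η)
    (by fun_prop) ?_ (by simp) (by fun_prop) ?_ (fun _ _ _ => by linarith)
    (right_mem_Icc.2 hab)
  · rw [dist_comm, dist_eq_norm]
    refine key.trans ?_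
    rw [add_mul]
    linarith
  · intro s hs r hr
    have h1 : ∃ᶠ z in 𝓝[>] s, ∃ j, z ∈ D j := by
      have : ∀ᶠ z in 𝓝[>] s, z ∈ Ioo s b := Ioo_mem_nhdsGT hs.2
      refine (this.mono fun z hz => mem_iUnion.1 (hcov ⟨hs.1.trans hz.1.le, hz.2.le⟩)).frequently
    obtain ⟨j, hj⟩ : ∃ j, ∃ᶠ z in 𝓝[>] s, z ∈ D j := by
      by_contra! hn
      exact h1 ((eventually_all.2 hn).mono fun z hz => not_exists.2 hz)
    have hsj : s ∈ D j := by
      rw [← (hD j).closure_eq, mem_closure_iff_frequently]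
      exact hj.filter_mono nhdsWithin_le_nhds
    refine (hj.and_eventually self_mem_nhdsWithin).mono fun z hz => lt_of_le_of_lt ?_ hr
    have hz2 : s < z := hz.2
    rw [slope_def_field, div_le_iff₀ (sub_pos.2 hz2)]
    have := hK j z hz.1 s hsj
    rw [abs_of_pos (sub_pos.2 hz2), dist_eq_norm] at this
    refine le_trans ?_ this
    have := norm_sub_norm_le (u z - u a) (u s - u a)
    simpa using this
  · intro t _
    simpa using (((hasDerivAt_id t).sub_const a).const_mul (K + η)).hasDerivWithinAt

end PiecewiseAffine

section FPLF

variable {n m : ℕ}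

lemma IsPolyhedron.isClosed {P : Set (EuclideanSpace ℝ (Fin n))} (hP : IsPolyhedron P) :
    IsClosed P := by
  obtain ⟨r, v, t, rfl⟩ := hP
  simp only [ofPred_forall]
  exact isClosed_iInter fun i => isClosed_le (by fun_prop) continuous_const

lemma IsPolyhedron.convex {P : Set (EuclideanSpace ℝ (Fin n))} (hP : IsPolyhedron P) :
    Convex ℝ P := by
  obtain ⟨r, v, t, rfl⟩ := hP
  simp only [ofPred_forall]
  exact convex_iInter fun i => convex_halfSpace_le (innerSL ℝ (v i)).toLinearMap.isLinear (t i)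

lemma IsFPLF.isPiecewiseAffine {f : EuclideanSpace ℝ (Fin n) → EuclideanSpace ℝ (Fin m)}
    (hf : IsFPLF f) : IsPiecewiseAffine f := by
  obtain ⟨r, P, hP, hcov, hA⟩ := hf
  choose A hA using hA
  exact ⟨Fin r, inferInstance, P, A, fun j => (hP j).isClosed, hcov, hA⟩

end FPLF

/-! ### Lipschitz constants of networks -/

section Network

lemma abs_sigmaA_sub_le {a : ℝ} (ha : -1 < a) (ha' : a < 1) (s t : ℝ) :
    |sigmaA a s - sigmaA a t| ≤ |s - t| := by
  unfold sigmaA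
  rw [abs_le]
  rcases abs_cases (s - t) with ⟨h, h'⟩ | ⟨h, h'⟩ <;> rw [h] <;> split_ifs <;>
    constructor <;> nlinarith

lemma dist_mulVec_add_le {n m : ℕ} (W : Matrix (Fin m) (Fin n) ℝ) (b : Fin m → ℝ)
    (x y : EuclideanSpace ℝ (Fin n)) :
    dist (WithLp.toLp 2 (W.mulVec x.ofLp + b) : EuclideanSpace ℝ (Fin m))
      (WithLp.toLp 2 (W.mulVec y.ofLp + b)) ≤ √(∑ i, ∑ j, W i j ^ 2) * dist x y := by
  rw [EuclideanSpace.dist_eq, EuclideanSpace.dist_eq, ← Real.sqrt_mul (by positivity)]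
  refine Real.sqrt_le_sqrt ?_
  rw [Finset.sum_mul]
  refine Finset.sum_le_sum fun i _ => ?_
  simp only [Real.dist_eq, sq_abs]
  have h : (W.mulVec x.ofLp + b) i - (W.mulVec y.ofLp + b) i
      = ∑ j, W i j * (x j - y j) := by
    simp [Matrix.mulVec, dotProduct, mul_sub, Finset.sum_sub_distrib]
  rw [h]
  exact Finset.sum_mul_sq_le_sq_mul_sq _ _ _

/-- A network is Lipschitz, the constant being the product of the Frobenius norms `√(c ℓ)` of its
weight matrices. -/
lemma Network.exists_lipschitz {a : ℝ} (ha : -1 < a) (ha' : a < 1) {L n m : ℕ}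
    (w : Network L n m) : ∃ c : Fin L → ℝ, (∀ l, 0 ≤ c l) ∧ ∑ l, c l ≤ w.normSq ∧
      ∀ x y, dist (w.eval (sigmaA a) x) (w.eval (sigmaA a) y) ≤ (∏ l, √(c l)) * dist x y := by
  induction w with
  | @output n m W b =>
    refine ⟨fun _ => ∑ i, ∑ j, W i j ^ 2, fun _ => by positivity, ?_, fun x y => ?_⟩
    · simp only [Finset.univ_unique, Finset.sum_const, Finset.card_singleton, one_smul, normSq]
      linarith [Finset.sum_nonneg fun (i : Fin m) (_ : i ∈ Finset.univ) => sq_nonneg (b i)]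
    · simpa [eval] using dist_mulVec_add_le W b x y
  | @hidden L n h m W b rest ih =>
    obtain ⟨c, hc, hsum, hlip⟩ := ih
    refine ⟨Fin.cons (∑ i, ∑ j, W i j ^ 2) c, ?_, ?_, fun x y => ?_⟩
    · refine Fin.cases ?_ hc
      simp only [Fin.cons_zero]
      positivity
    · simp only [Fin.sum_univ_succ, Fin.cons_zero, Fin.cons_succ, normSq]
      linarith [Finset.sum_nonneg fun (i : Fin h) (_ : i ∈ Finset.univ) => sq_nonneg (b i)]
    · simp only [Fin.prod_univ_succ, Fin.cons_zero, Fin.cons_succ, eval]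
      refine (hlip _ _).trans ?_
      rw [mul_comm (√_) (∏ l, √(c l)), mul_assoc]
      refine mul_le_mul_of_nonneg_left ?_ (by positivity)
      refine le_trans ?_ (dist_mulVec_add_le W b x y)
      rw [EuclideanSpace.dist_eq, EuclideanSpace.dist_eq]
      refine Real.sqrt_le_sqrt (Finset.sum_le_sum fun i _ => ?_)
      simp only [Real.dist_eq]
      exact pow_le_pow_left₀ (abs_nonneg _) (abs_sigmaA_sub_le ha ha' _ _) 2

/-- The inequality between the arithmetic and the geometric mean for the squared layer norms. -/
lemma mul_prod_sqrt_rpow_le_sum {L : ℕ} (hL : 1 ≤ L) {c : Fin L → ℝ} (hc : ∀ l, 0 ≤ c l) :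
    (L : ℝ) * (∏ l, √(c l)) ^ (2 / (L : ℝ)) ≤ ∑ l, c l := by
  have hL0 : (0 : ℝ) < L := by exact_mod_cast hL
  have h := Real.geom_mean_le_arith_mean_weighted Finset.univ (fun _ : Fin L => (1 / L : ℝ)) c
    (fun _ _ => by positivity) (by simp [hL0.ne']) (fun l _ => hc l)
  rw [← Finset.mul_sum, one_div_mul_eq_div, le_div_iff₀ hL0] at h
  rw [mul_comm]
  refine le_trans (le_of_eq ?_) h
  congr 1
  rw [← Real.finsetProd_rpow _ _ fun l _ => Real.sqrt_nonneg _]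
  refine Finset.prod_congr rfl fun l _ => ?_
  rw [Real.sqrt_eq_rpow, ← Real.rpow_mul (hc l)]
  congr 1
  ring

end Network

/-! ### Shortest paths -/

section Path

variable {m N : ℕ}

lemma tsp_le_sum (y : Fin N → EuclideanSpace ℝ (Fin m)) (π : Equiv.Perm (Fin N)) :
    tsp y ≤ ∑ i : Fin (N - 1), dist (y (π ⟨i, by omega⟩)) (y (π ⟨i + 1, by omega⟩)) :=
  ciInf_le (Set.finite_range _).bddBelow π

lemma tsp_eq_zero_of_forall_eq {y : Fin N → EuclideanSpace ℝ (Fin m)}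
    (hy : ∀ i j, y i = y j) : tsp y = 0 := by
  unfold tsp
  simp [dist_eq_zero.2 (hy _ _)]

/-- If `f` depends only on a real-valued continuous function `g` on a set containing the convex hull
of the points `x i`, then along the segment from a minimum of `g` over these points to a maximum `f`
takes all the values `f (x i)`, in the order of the values of `g`, so that a Lipschitz constant `K`
for this curve, parametrized by `[0, 1]`, bounds the length of the shortest path. -/
lemma exists_tsp_le_of_factor {E : Type*} [NormedAddCommGroup E] [NormedSpace ℝ E]
    {f : E → EuclideanSpace ℝ (Fin m)} {g : E → ℝ} (hg : Continuous g) {Ω : Set E}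
    (hfac : ∀ u ∈ Ω, ∀ v ∈ Ω, g u = g v → f u = f v) (hN : 1 ≤ N) {x : Fin N → E}
    (hx : convexHull ℝ (range x) ⊆ Ω) :
    ∃ i j, ∀ K : ℝ, (∀ s t : ℝ, 0 ≤ s → s ≤ t → t ≤ 1 →
      dist (f (AffineMap.lineMap (x i) (x j) s)) (f (AffineMap.lineMap (x i) (x j) t))
        ≤ K * (t - s)) → tsp (fun i => f (x i)) ≤ K := by
  obtain ⟨M, rfl⟩ : ∃ M, N = M + 1 := ⟨N - 1, by omega⟩
  set σ := Tuple.sort (g ∘ x) with hσ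
  have hmono : Monotone fun k => g (x (σ k)) := Tuple.monotone_sort (g ∘ x)
  refine ⟨σ 0, σ (Fin.last M), fun K hK => ?_⟩
  set ℓ : ℝ → E := fun s => AffineMap.lineMap (x (σ 0)) (x (σ (Fin.last M))) s with hℓ
  have hℓc : Continuous ℓ := AffineMap.lineMap_continuous
  have hℓ0 : ℓ 0 = x (σ 0) := by simp [hℓ]
  have hℓ1 : ℓ 1 = x (σ (Fin.last M)) := by simp [hℓ]
  have hxm : ∀ i, x i ∈ convexHull ℝ (range x) := fun i => subset_convexHull ℝ _ ⟨i, rfl⟩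
  have hℓΩ : ∀ s ∈ Icc (0 : ℝ) 1, ℓ s ∈ Ω := by
    intro s hs
    refine hx ((convex_convexHull ℝ (range x)).segment_subset (hxm (σ 0)) (hxm (σ (Fin.last M))) ?_)
    rw [segment_eq_image_lineMap]
    exact mem_image_of_mem _ hs
  -- `s k` is the first time at which `g` reaches its `k`-th smallest value on the points.
  set S : Fin (M + 1) → Set ℝ := fun k => Icc 0 1 ∩ {s | g (x (σ k)) ≤ g (ℓ s)} with hS
  set s : Fin (M + 1) → ℝ := fun k => sInf (S k) with hs
  have hSc : ∀ k, IsCompact (S k) := fun k =>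
    isCompact_Icc.inter_right (isClosed_le continuous_const (hg.comp hℓc))
  have h1S : ∀ k, (1 : ℝ) ∈ S k := fun k =>
    ⟨by simp, by simpa [hℓ1] using hmono (Fin.le_last k)⟩
  have hsS : ∀ k, s k ∈ S k := fun k => (hSc k).sInf_mem ⟨1, h1S k⟩
  have hs_le : ∀ k, ∀ t ∈ S k, s k ≤ t := fun k t ht => csInf_le (hSc k).bddBelow ht
  have hs_mono : ∀ k l, k ≤ l → s k ≤ s l := fun k l hkl =>
    hs_le k _ ⟨(hsS l).1, (hmono hkl).trans (hsS l).2⟩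
  have hval : ∀ k, f (ℓ (s k)) = f (x (σ k)) := by
    intro k
    obtain ⟨t, ht, htv⟩ := intermediate_value_Icc (f := fun t => g (ℓ t)) (hsS k).1.1
      (hg.comp hℓc).continuousOn
      (⟨by simpa [hℓ0] using hmono (Fin.zero_le k), (hsS k).2⟩ :
        g (x (σ k)) ∈ Icc (g (ℓ 0)) (g (ℓ (s k))))
    have : s k = t := le_antisymm
      (hs_le k t ⟨⟨ht.1, ht.2.trans (hsS k).1.2⟩, htv.ge⟩) ht.2
    refine hfac _ (hℓΩ _ (hsS k).1) _ (hx (hxm _)) ?_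
    rw [this]
    exact htv
  have hK0 : 0 ≤ K := by
    have := dist_nonneg.trans (hK 0 1 le_rfl zero_le_one le_rfl)
    linarith
  refine (tsp_le_sum _ σ).trans ?_
  set T : ℕ → ℝ := fun k => if h : k < M + 1 then s ⟨k, h⟩ else 0 with hT
  have hTs : ∀ k (h : k < M + 1), T k = s ⟨k, h⟩ := fun k h => dif_pos h
  calc _ ≤ ∑ i : Fin M, K * (T (i + 1) - T i) := by
        refine Finset.sum_le_sum fun i _ => ?_
        rw [hTs i (by omega), hTs (i + 1) (by omega), ← hval, ← hval]
        exact hK _ _ (hsS _).1.1 (hs_mono _ _ (by simp [Fin.le_def])) (hsS _).1.2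
    _ = K * (T M - T 0) := by
        rw [← Finset.mul_sum, Fin.sum_univ_eq_sum_range (fun i => T (i + 1) - T i),
          Finset.sum_range_sub]
    _ ≤ K * 1 := by
        refine mul_le_mul_of_nonneg_left ?_ hK0
        rw [hTs M (by omega), hTs 0 (by omega)]
        linarith [(hsS ⟨M, by omega⟩).1.2, (hsS ⟨0, by omega⟩).1.1]
    _ = K := mul_one K

/-- A path through all the points leaves each point of `G`, with one possible exception, along an
edge of length at least `r`, unless this edge joins one of the pairs at distance less than `r`. -/
lemma mul_card_sub_le_tsp (y : Fin N → EuclideanSpace ℝ (Fin m)) (G : Finset (Fin N)) {r : ℝ}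
    (hr : 0 ≤ r) :
    r * (G.card - 1 - (Finset.univ.filter fun p : Fin N × Fin N =>
      p.1 ≠ p.2 ∧ p.1 ∈ G ∧ dist (y p.1) (y p.2) < r).card) ≤ tsp y := by
  refine le_ciInf fun π => ?_
  rcases N.eq_zero_or_pos with rfl | hN
  · have : G.card = 0 := by simp [Finset.eq_empty_of_isEmpty G]
    have h2 : (0 : ℝ) ≤ (Finset.univ.filter fun p : Fin 0 × Fin 0 =>
      p.1 ≠ p.2 ∧ p.1 ∈ G ∧ dist (y p.1) (y p.2) < r).card := by positivity
    simp only [this, Nat.cast_zero]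
    refine le_trans ?_ (Finset.sum_nonneg fun _ _ => dist_nonneg)
    nlinarith
  obtain ⟨M, rfl⟩ : ∃ M, N = M + 1 := ⟨N - 1, by omega⟩
  change _ ≤ ∑ i : Fin M, dist (y (π i.castSucc)) (y (π i.succ))
  set I := Finset.univ.filter fun i : Fin M => π i.castSucc ∈ G with hI
  set J := I.filter fun i => dist (y (π i.castSucc)) (y (π i.succ)) < r with hJ
  set P := Finset.univ.filter fun p : Fin (M + 1) × Fin (M + 1) =>
      p.1 ≠ p.2 ∧ p.1 ∈ G ∧ dist (y p.1) (y p.2) < r with hP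
  have hGI : G.card ≤ I.card + 1 := by
    have hsub : G ⊆ insert (π (Fin.last M)) (I.image fun i => π i.castSucc) := by
      intro j hj
      obtain ⟨k, rfl⟩ := π.surjective j
      induction k using Fin.lastCases with
      | last => exact Finset.mem_insert_self _ _
      | cast i =>
        exact Finset.mem_insert_of_mem (Finset.mem_image.2 ⟨i, by simpa [hI] using hj, rfl⟩)
    exact (Finset.card_le_card hsub).trans ((Finset.card_insert_le _ _).trans
      (Nat.succ_le_succ Finset.card_image_le))
  have hJP : J.card ≤ P.card := by
    refine Finset.card_le_card_of_injOn (fun i => (π i.castSucc, π i.succ)) ?_ ?_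
    · intro i hi
      simp only [hJ, hI, Finset.coe_filter, Finset.mem_filter, Finset.mem_univ, true_and,
        mem_ofPred_eq] at hi
      simp only [hP, Finset.coe_filter, Finset.mem_univ, true_and, mem_ofPred_eq]
      exact ⟨fun h => (Fin.castSucc_lt_succ).ne (π.injective h), hi.1, hi.2⟩
    · intro i _ j _ h
      exact Fin.castSucc_injective _ (π.injective (Prod.ext_iff.1 h).1)
  have hcard : (I.card : ℝ) = J.card + (I.filter fun i =>
      ¬ dist (y (π i.castSucc)) (y (π i.succ)) < r).card := by
    exact_mod_cast (Finset.card_filter_add_card_filter_not _).symm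
  have hsum : ((I.filter fun i => ¬ dist (y (π i.castSucc)) (y (π i.succ)) < r).card : ℝ) * r ≤
      ∑ i : Fin M, dist (y (π i.castSucc)) (y (π i.succ)) := by
    rw [← nsmul_eq_mul]
    refine (Finset.card_nsmul_le_sum _ _ r fun i hi => ?_).trans
      (Finset.sum_le_sum_of_subset_of_nonneg (Finset.subset_univ _) fun _ _ _ => dist_nonneg)
    exact not_lt.1 (Finset.mem_filter.1 hi).2
  refine le_trans ?_ hsum
  rw [mul_comm]
  refine mul_le_mul_of_nonneg_right ?_ hr
  have h1 : (G.card : ℝ) ≤ I.card + 1 := by exact_mod_cast hGI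
  have h2 : (J.card : ℝ) ≤ P.card := by exact_mod_cast hJP
  linarith

end Path

/-! ### Interpolation by functions of bottleneck rank one -/

section Interpolation

variable {n m N : ℕ} {f : EuclideanSpace ℝ (Fin n) → EuclideanSpace ℝ (Fin m)}
  {Ω : Set (EuclideanSpace ℝ (Fin n))} {x : Fin N → EuclideanSpace ℝ (Fin n)}

lemma exists_factor_of_rankBN_eq_one (h : rankBN f Ω = 1) :
    ∃ (g : EuclideanSpace ℝ (Fin n) → EuclideanSpace ℝ (Fin 1))
      (h : EuclideanSpace ℝ (Fin 1) → EuclideanSpace ℝ (Fin m)),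
      IsFPLF g ∧ IsFPLF h ∧ EqOn f (h ∘ g) Ω := by
  have hne := Nat.nonempty_of_pos_sInf (h.symm ▸ Nat.one_pos : 0 < rankBN f Ω)
  have := Nat.sInf_mem hne
  rw [show sInf _ = 1 from h] at this
  exact this

/-- The case of bottleneck rank one of `exists_tsp_le_of_factor`, phrased with the diameter. -/
lemma exists_tsp_div_diam_le (hrank : rankBN f Ω = 1) (hN : 1 ≤ N)
    (hx : convexHull ℝ (range x) ⊆ Ω) :
    ∃ u v, segment ℝ u v ⊆ Ω ∧ ∀ K : ℝ, 0 ≤ K →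
      (∀ s t : ℝ, 0 ≤ s → s ≤ t → t ≤ 1 →
        dist (f (AffineMap.lineMap u v s)) (f (AffineMap.lineMap u v t))
          ≤ K * dist u v * (t - s)) →
      tsp (fun i => f (x i)) / Metric.diam (range x) ≤ K := by
  obtain ⟨g, h, hg, -, hfg⟩ := exists_factor_of_rankBN_eq_one hrank
  obtain ⟨i, j, hij⟩ := exists_tsp_le_of_factor (f := f) (g := fun z => g z 0) (Ω := Ω) (x := x)
    (by have := hg.isPiecewiseAffine.continuous; fun_prop) (fun u hu v hv huv => by
      rw [hfg hu, hfg hv]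
      have : g u = g v := by
        ext k
        rw [Subsingleton.elim k 0]
        exact huv
      simp [this]) hN hx
  have hxm : ∀ i, x i ∈ convexHull ℝ (range x) := fun i => subset_convexHull ℝ _ ⟨i, rfl⟩
  refine ⟨x i, x j, ((convex_convexHull ℝ _).segment_subset (hxm i) (hxm j)).trans hx,
    fun K hK hlip => ?_⟩
  refine div_le_of_le_mul₀ Metric.diam_nonneg hK ((hij _ hlip).trans ?_)
  exact mul_le_mul_of_nonneg_left (Metric.dist_le_diam_of_mem (finite_range x).isBounded
    (mem_range_self i) (mem_range_self j)) hK

lemma lineMap_mem_of_segment_subset {E : Type*} [AddCommGroup E] [Module ℝ E] {u v : E} {S : Set E}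
    (h : segment ℝ u v ⊆ S) {s : ℝ} (hs : s ∈ Icc (0 : ℝ) 1) : AffineMap.lineMap u v s ∈ S := by
  refine h ?_
  rw [segment_eq_image_lineMap]
  exact mem_image_of_mem _ hs

lemma mul_tsp_div_diam_rpow_le_normSq (hrank : rankBN f Ω = 1) (hN : 1 ≤ N)
    (hx : convexHull ℝ (range x) ⊆ Ω) {L : ℕ} (hL : 1 ≤ L) {a : ℝ} (ha : -1 < a) (ha' : a < 1)
    {w : Network L n m} (hw : EqOn (w.eval (sigmaA a)) f Ω) :
    (L : ℝ) * (tsp (fun i => f (x i)) / Metric.diam (range x)) ^ (2 / (L : ℝ)) ≤ w.normSq := by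
  obtain ⟨u, v, huv, hK⟩ := exists_tsp_div_diam_le hrank hN hx
  obtain ⟨c, hc, hsum, hlip⟩ := w.exists_lipschitz ha ha'
  have key := hK (∏ l, √(c l)) (by positivity) fun s t hs hst ht => by
    rw [← hw (lineMap_mem_of_segment_subset huv ⟨hs, hst.trans ht⟩),
      ← hw (lineMap_mem_of_segment_subset huv ⟨hs.trans hst, ht⟩)]
    refine (hlip _ _).trans (le_of_eq ?_)
    rw [dist_lineMap_lineMap, Real.dist_eq, abs_sub_comm, abs_of_nonneg (sub_nonneg.2 hst)]
    ring
  refine le_trans ?_ ((mul_prod_sqrt_rpow_le_sum hL hc).trans hsum)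
  have h0 : 0 ≤ tsp (fun i => f (x i)) := Real.iInf_nonneg fun _ => by positivity
  have : (0 : ℝ) ≤ Metric.diam (range x) := Metric.diam_nonneg
  gcongr

lemma ofReal_tsp_div_diam_rpow_le_reprCost (hrank : rankBN f Ω = 1) (hN : 1 ≤ N)
    (hx : convexHull ℝ (range x) ⊆ Ω) {L : ℕ} (hL : 1 ≤ L) {a : ℝ} (ha : -1 < a) (ha' : a < 1) :
    ENNReal.ofReal ((tsp (fun i => f (x i)) / Metric.diam (range x)) ^ (2 / (L : ℝ)))
      ≤ reprCost f Ω (sigmaA a) L / (L : ℝ≥0∞) := by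
  rw [ENNReal.le_div_iff_mul_le (by simp; omega) (by simp)]
  refine le_iInf₂ fun w hw => ?_
  rw [mul_comm, ← ENNReal.ofReal_natCast L, ← ENNReal.ofReal_mul (by positivity)]
  exact ENNReal.ofReal_le_ofReal (mul_tsp_div_diam_rpow_le_normSq hrank hN hx hL ha ha' hw)

/-- Among the affine pieces of the factorized function whose interior meets the interior of `Ω`, one
of the largest operator norm provides the point with the large Jacobian. -/
lemma exists_tsp_div_diam_le_norm_fderiv (hrank : rankBN f Ω = 1) (hN : 1 ≤ N)
    (hx : convexHull ℝ (range x) ⊆ Ω) (hΩ : Ω ⊆ closure (interior Ω)) :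
    ∃ z ∈ Ω, DifferentiableAt ℝ f z ∧
      tsp (fun i => f (x i)) / Metric.diam (range x) ≤ ‖fderiv ℝ f z‖ := by
  obtain ⟨g, h, hg, hh, hfg⟩ := exists_factor_of_rankBN_eq_one hrank
  have hpa := hh.isPiecewiseAffine.comp hg.isPiecewiseAffine
  have hcont := hpa.continuous
  obtain ⟨ι, _, C, A, hC, hcov, hA⟩ := hpa
  obtain ⟨u, v, huv, hK⟩ := exists_tsp_div_diam_le hrank hN hx
  set good : Set ι := {j | (interior (C j) ∩ interior Ω).Nonempty} with hgood
  have hex : ∀ z ∈ Ω, ∃ j ∈ good, z ∈ C j := by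
    intro z hz
    obtain ⟨j, hj⟩ := exists_mem_closure_interior_inter hC hcov hΩ hz
    refine ⟨j, closure_nonempty_iff.1 ⟨z, hj⟩, ?_⟩
    rw [← (hC j).closure_eq]
    exact closure_mono (inter_subset_left.trans interior_subset) hj
  have hne : good.Nonempty := by
    obtain ⟨j, hj, -⟩ := hex u (huv (left_mem_segment ℝ u v))
    exact ⟨j, hj⟩
  obtain ⟨j, ⟨z, hzC, hzΩ⟩, hmax⟩ := good.toFinite.exists_maximalFor
    (fun j => ‖LinearMap.toContinuousLinearMap (A j).linear‖) good hne
  have hder : HasFDerivAt f (LinearMap.toContinuousLinearMap (A j).linear) z := by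
    refine ((A j).hasFDerivAt_of_finiteDimensional z).congr_of_eventuallyEq ?_
    filter_upwards [isOpen_interior.mem_nhds hzC, isOpen_interior.mem_nhds hzΩ] with y hy hy'
    rw [hfg (interior_subset hy'), hA j (interior_subset hy)]
  refine ⟨z, interior_subset hzΩ, hder.differentiableAt, ?_⟩
  rw [hder.fderiv]
  refine hK _ (norm_nonneg _) fun s t hs hst ht => ?_
  have hmem : ∀ r ∈ Icc s t, AffineMap.lineMap u v r ∈ Ω := fun r hr =>
    lineMap_mem_of_segment_subset huv ⟨hs.trans hr.1, hr.2.trans ht⟩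
  rw [hfg (hmem s ⟨le_rfl, hst⟩), hfg (hmem t ⟨hst, le_rfl⟩)]
  refine dist_le_of_finite_closed_cover (ι := good)
    (u := fun r => (h ∘ g) (AffineMap.lineMap u v r))
    (D := fun j => (fun r : ℝ => AffineMap.lineMap u v r) ⁻¹' C j)
    (hcont.comp AffineMap.lineMap_continuous)
    (fun j => (hC j).preimage AffineMap.lineMap_continuous) ?_ ?_ hst
  · intro r hr
    obtain ⟨i, hi, hi'⟩ := hex _ (hmem r hr)
    exact mem_iUnion.2 ⟨⟨i, hi⟩, hi'⟩
  · rintro ⟨i, hi⟩ r hr r' hr'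
    have h1 : ‖LinearMap.toContinuousLinearMap (A i).linear‖ ≤
        ‖LinearMap.toContinuousLinearMap (A j).linear‖ := by
      by_contra! hlt
      exact absurd (hmax hi hlt.le) (not_le.2 hlt)
    simp only [hA i hr, hA i hr']
    refine ((A i).dist_le_of_finiteDimensional _ _).trans ?_
    rw [dist_lineMap_lineMap, Real.dist_eq, mul_assoc, mul_comm |r - r'|]
    gcongr

end Interpolation

/-! ### Small balls for affine images of a measure -/

section SmallBall

variable {n m : ℕ}

/-- Where an FPLF attains its Jacobian rank, it is affine of that rank on a nearby ball. The pieces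
being convex with nonempty interior, the derivative at a point of their boundary, if it exists, is
still the linear part of the affine map on the piece. -/
lemma IsFPLF.exists_ball_eqOn_affine {f : EuclideanSpace ℝ (Fin n) → EuclideanSpace ℝ (Fin m)}
    (hf : IsFPLF f) {Ω : Set (EuclideanSpace ℝ (Fin n))} (hΩ : Ω ⊆ closure (interior Ω))
    (hk : 1 ≤ rankJ f Ω) :
    ∃ (A : EuclideanSpace ℝ (Fin n) →ᵃ[ℝ] EuclideanSpace ℝ (Fin m)) (c : EuclideanSpace ℝ (Fin n))
      (r : ℝ), 0 < r ∧ Metric.ball c r ⊆ Ω ∧ EqOn f A (Metric.ball c r) ∧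
      Module.finrank ℝ (LinearMap.range A.linear) = rankJ f Ω := by
  have hne : {r : ℕ | ∃ x ∈ Ω, DifferentiableAt ℝ f x ∧
      Module.finrank ℝ (LinearMap.range (fderiv ℝ f x).toLinearMap) = r}.Nonempty := by
    by_contra h
    rw [rankJ, not_nonempty_iff_eq_empty.1 h] at hk
    simp at hk
  obtain ⟨x, hxΩ, hdiff, hrank⟩ := Nat.sSup_mem hne ⟨m, by
    rintro r ⟨x, -, -, rfl⟩
    simpa using Submodule.finrank_le (LinearMap.range (fderiv ℝ f x).toLinearMap)⟩
  obtain ⟨N, P, hP, hcov, hA⟩ := hf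
  choose A hA using hA
  obtain ⟨j, hj⟩ := exists_mem_closure_interior_inter (fun j => (hP j).isClosed) hcov hΩ hxΩ
  have hxP : x ∈ P j := by
    rw [← (hP j).isClosed.closure_eq]
    exact closure_mono (inter_subset_left.trans interior_subset) hj
  obtain ⟨c, hcP, hcΩ⟩ := closure_nonempty_iff.1 ⟨x, hj⟩
  obtain ⟨r, hr, hball⟩ := Metric.isOpen_iff.1 (isOpen_interior.inter isOpen_interior) c
    (⟨hcP, hcΩ⟩ : c ∈ interior (P j) ∩ interior Ω)
  refine ⟨A j, c, r, hr, fun y hy => interior_subset (hball hy).2,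
    fun y hy => hA j (interior_subset (hball hy).1), ?_⟩
  have hu : UniqueDiffWithinAt ℝ (P j) x :=
    uniqueDiffWithinAt_convex (hP j).convex ⟨c, hcP⟩ (subset_closure hxP)
  have heq := hu.eq (hdiff.hasFDerivAt.hasFDerivWithinAt)
    ((((A j).hasFDerivAt_of_finiteDimensional x).hasFDerivWithinAt).congr (hA j) (hA j hxP))
  rw [heq] at hrank
  exact hrank

/-- The part of a bounded set that an affine map of rank `k` sends into a ball of radius `r` has
volume `O(r ^ k)`: in coordinates `range × ker` it lies in the product of a ball of radius `2 r` and
a fixed ball. -/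
lemma exists_volume_dist_lt_le (A : EuclideanSpace ℝ (Fin n) →ᵃ[ℝ] EuclideanSpace ℝ (Fin m))
    {B : Set (EuclideanSpace ℝ (Fin n))} (hB : Bornology.IsBounded B) :
    ∃ C : ℝ≥0∞, C ≠ ∞ ∧ ∀ v r, 0 ≤ r → volume {x ∈ B | dist (A x) v < r} ≤
      C * ENNReal.ofReal (r ^ Module.finrank ℝ (LinearMap.range A.linear)) := by
  set T := A.linear
  set R := LinearMap.range T
  set K := LinearMap.ker T
  obtain ⟨q, hq⟩ := LinearMap.exists_leftInverse_of_injective K.subtype (by simp)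
  have hq' : ∀ y : K, q y = y := fun y => by
    simpa using LinearMap.congr_fun hq y
  have hqr : LinearMap.range q = ⊤ := LinearMap.range_eq_top.2 fun y => ⟨y, hq' y⟩
  have hcompl : IsCompl (LinearMap.ker T.rangeRestrict) (LinearMap.ker q) := by
    rw [LinearMap.ker_rangeRestrict]
    exact LinearMap.isCompl_of_proj hq'
  let Φ := (LinearMap.equivProdOfSurjectiveOfIsCompl T.rangeRestrict q
    (LinearMap.range_rangeRestrict T) hqr hcompl).toContinuousLinearEquiv
  have hΦ : ∀ y, Φ y = (T.rangeRestrict y, q y) := fun _ => rfl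
  let μR : Measure R := Measure.addHaar
  let μK : Measure K := Measure.addHaar
  have hmeas : Measurable Φ := Φ.continuous.measurable
  have : (Measure.map Φ volume).IsAddHaarMeasure := Φ.isAddHaarMeasure_map volume
  have hν := Measure.isAddLeftInvariant_eq_smul
    (Measure.map Φ (volume : Measure (EuclideanSpace ℝ (Fin n)))) (μR.prod μK)
  set c := Measure.addHaarScalarFactor
    (Measure.map Φ (volume : Measure (EuclideanSpace ℝ (Fin n)))) (μR.prod μK)
  obtain ⟨ρ, hρ⟩ := hB.exists_norm_le
  set Q := Metric.closedBall (0 : K) (‖LinearMap.toContinuousLinearMap q‖ * ρ)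
  refine ⟨c * (ENNReal.ofReal (2 ^ Module.finrank ℝ R) * μR (Metric.ball 0 1) * μK Q),
    ENNReal.mul_ne_top ENNReal.coe_ne_top (ENNReal.mul_ne_top (ENNReal.mul_ne_top ENNReal.ofReal_ne_top
      Metric.isBounded_ball.measure_lt_top.ne) Metric.isBounded_closedBall.measure_lt_top.ne),
    fun v r hr => ?_⟩
  rcases Set.eq_empty_or_nonempty {x ∈ B | dist (A x) v < r} with h | ⟨x₀, hx₀B, hx₀⟩
  · simp [h]
  have hsub : {x ∈ B | dist (A x) v < r} ⊆
      Φ ⁻¹' (Metric.closedBall (T.rangeRestrict x₀) (2 * r) ×ˢ Q) := by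
    rintro x ⟨hxB, hx⟩
    rw [mem_preimage, hΦ]
    refine ⟨?_, ?_⟩
    · rw [Metric.mem_closedBall, Subtype.dist_eq]
      change dist (T x) (T x₀) ≤ 2 * r
      have h1 : dist (T x) (T x₀) = dist (A x) (A x₀) := by
        rw [dist_eq_norm, dist_eq_norm, ← map_sub, ← vsub_eq_sub, ← vsub_eq_sub (A x),
          A.linearMap_vsub]
      rw [h1]
      linarith [dist_triangle_right (A x) (A x₀) v]
    · rw [mem_closedBall_zero_iff]
      exact ((LinearMap.toContinuousLinearMap q).le_opNorm x).trans
        (mul_le_mul_of_nonneg_left (hρ x hxB) (by positivity))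
  calc _ ≤ volume (Φ ⁻¹' (Metric.closedBall (T.rangeRestrict x₀) (2 * r) ×ˢ Q)) :=
        measure_mono hsub
    _ = Measure.map Φ volume (Metric.closedBall (T.rangeRestrict x₀) (2 * r) ×ˢ Q) :=
        (Measure.map_apply hmeas
          (Metric.isClosed_closedBall.measurableSet.prod Metric.isClosed_closedBall.measurableSet)).symm
    _ = c * (ENNReal.ofReal ((2 * r) ^ Module.finrank ℝ R) * μR (Metric.ball 0 1) * μK Q) := by
        rw [hν, Measure.smul_apply, ENNReal.smul_def, Measure.prod_prod, smul_eq_mul,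
          Measure.addHaar_closedBall μR _ (by positivity)]
    _ = _ := by
        rw [mul_pow, ENNReal.ofReal_mul (by positivity)]
        ring

/-- A finite measure that is not singular with respect to `ν` is bounded by a multiple of `ν` on a
set of positive measure: a sublevel set of its density, off the support of its singular part. -/
lemma exists_measurableSet_measure_le_mul {α : Type*} [MeasurableSpace α] {μ ν : Measure α}
    [IsFiniteMeasure μ] [SigmaFinite ν] (h : ¬ Measure.MutuallySingular μ ν) :
    ∃ E, MeasurableSet E ∧ μ E ≠ 0 ∧ ∃ M : ℕ, ∀ t ⊆ E, MeasurableSet t → μ t ≤ M * ν t := by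
  have hs := Measure.mutuallySingular_singularPart μ ν
  set S := hs.nullSet with hS
  have hdecomp := Measure.haveLebesgueDecomposition_add μ ν
  have hmeas := Measure.measurable_rnDeriv μ ν
  have hon : ∀ t ⊆ S, MeasurableSet t → μ t = ∫⁻ y in t, μ.rnDeriv ν y ∂ν := by
    intro t ht htm
    conv_lhs => rw [hdecomp]
    rw [Measure.add_apply, withDensity_apply _ htm, measure_mono_null ht hs.measure_nullSet,
      zero_add]
  by_contra! hcon
  refine h ⟨S, hs.measurableSet_nullSet, ?_, hs.measure_compl_nullSet⟩
  have hM : ∀ M : ℕ, μ (S ∩ {y | μ.rnDeriv ν y ≤ M}) = 0 := by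
    intro M
    by_contra hne
    have hE : MeasurableSet (S ∩ {y | μ.rnDeriv ν y ≤ M}) :=
      hs.measurableSet_nullSet.inter (measurableSet_le hmeas measurable_const)
    obtain ⟨t, ht, htm, hlt⟩ := hcon _ hE hne M
    refine hlt.not_ge ?_
    rw [hon t (ht.trans inter_subset_left) htm, ← setLIntegral_const]
    exact setLIntegral_mono measurable_const fun y hy => (ht hy).2
  have htop : μ (S ∩ {y | μ.rnDeriv ν y = ∞}) = 0 := by
    rw [hon _ inter_subset_left
      (hs.measurableSet_nullSet.inter (measurableSet_eq_fun hmeas measurable_const))]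
    refine setLIntegral_measure_zero _ _ (measure_mono_null inter_subset_right ?_)
    have := Measure.rnDeriv_lt_top μ ν
    rw [ae_iff] at this
    simpa using this
  refine measure_mono_null (fun y hy => ?_)
    (measure_union_null (measure_iUnion_null hM) htop)
  by_cases hy' : μ.rnDeriv ν y = ∞
  · exact Or.inr ⟨hy, hy'⟩
  · obtain ⟨M, hM⟩ := ENNReal.exists_nat_gt hy'
    exact Or.inl (mem_iUnion.2 ⟨M, hy, hM.le⟩)

/-- The small ball estimate: on some set `E` of positive probability inside a ball contained in
`Ω`, the image under `f` of the probability measure gives mass `O(r ^ k)` to the balls of radius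
`r`, where `k` is the Jacobian rank of `f`. -/
lemma IsFPLF.exists_small_ball {f : EuclideanSpace ℝ (Fin n) → EuclideanSpace ℝ (Fin m)}
    (hf : IsFPLF f) {Ω : Set (EuclideanSpace ℝ (Fin n))} (hΩ : Ω ⊆ closure (interior Ω))
    (hk : 1 ≤ rankJ f Ω) {p : Measure (EuclideanSpace ℝ (Fin n))} [IsFiniteMeasure p]
    (hsupp : p.support = closure Ω)
    (hsing : ∀ U : Set (EuclideanSpace ℝ (Fin n)), IsOpen U → p U ≠ 0 →
      ¬ Measure.MutuallySingular (p.restrict U) volume) :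
    ∃ E, MeasurableSet E ∧ convexHull ℝ E ⊆ Ω ∧ p E ≠ 0 ∧ ∃ C : ℝ, 0 < C ∧ ∀ v r, 0 ≤ r →
      p {x ∈ E | dist (f x) v < r} ≤ ENNReal.ofReal (C * r ^ rankJ f Ω) := by
  have hfc := hf.isPiecewiseAffine.continuous
  obtain ⟨A, c, r₀, hr₀, hball, hfA, hrank⟩ := hf.exists_ball_eqOn_affine hΩ hk
  set U := Metric.ball c r₀
  have hpU : p U ≠ 0 := by
    have hc : c ∈ p.support := hsupp ▸ subset_closure (hball (Metric.mem_ball_self hr₀))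
    exact ((Measure.mem_support_iff_forall c).1 hc U (Metric.ball_mem_nhds c hr₀)).ne'
  obtain ⟨E, hE, hpE, M, hM⟩ :=
    exists_measurableSet_measure_le_mul (hsing U Metric.isOpen_ball hpU)
  obtain ⟨C, hC, hvol⟩ := exists_volume_dist_lt_le A (Metric.isBounded_ball (x := c) (r := r₀))
  have hUm : MeasurableSet U := Metric.isOpen_ball.measurableSet
  refine ⟨E ∩ U, hE.inter hUm, ?_, by rwa [← Measure.restrict_apply hE], (M * C).toReal + 1,
    by positivity, fun v r hr => ?_⟩
  · exact (convexHull_min inter_subset_right (convex_ball c r₀)).trans hball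
  have hMC : (M : ℝ≥0∞) * C ≠ ∞ := ENNReal.mul_ne_top (by simp) hC
  have hmeas : MeasurableSet {x ∈ E ∩ U | dist (f x) v < r} :=
    (hE.inter hUm).inter (measurableSet_lt (f := fun x => dist (f x) v) (by fun_prop) measurable_const)
  calc p {x ∈ E ∩ U | dist (f x) v < r}
      = p.restrict U {x ∈ E ∩ U | dist (f x) v < r} := by
        rw [Measure.restrict_apply hmeas]
        exact congrArg p (inter_eq_left.2 fun x hx => hx.1.2).symm
    _ ≤ M * volume {x ∈ E ∩ U | dist (f x) v < r} := hM _ (fun x hx => hx.1.1) hmeas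
    _ ≤ M * volume {x ∈ U | dist (A x) v < r} := by
        refine mul_le_mul' le_rfl (measure_mono ?_)
        rintro x ⟨⟨_, hxU⟩, hx⟩
        exact ⟨hxU, by rwa [← hfA hxU]⟩
    _ ≤ M * (C * ENNReal.ofReal (r ^ rankJ f Ω)) := by
        gcongr
        exact hrank ▸ hvol v r hr
    _ ≤ ENNReal.ofReal (((M * C).toReal + 1) * r ^ rankJ f Ω) := by
        rw [← mul_assoc, ENNReal.ofReal_mul (by positivity)]
        gcongr
        rw [← ENNReal.ofReal_toReal hMC]
        exact ENNReal.ofReal_le_ofReal (by simp)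

end SmallBall

/-! ### Counting samples and close pairs of samples -/

section Sampling

variable {α : Type*} [MeasurableSpace α] {p : Measure α} [IsProbabilityMeasure p] {N : ℕ}

open Classical in
/-- By Chebyshev's inequality, at least half of the expected number of samples lie in `E`, up to a
probability `O(1 / N)`. -/
lemma measure_card_mem_lt_le {E : Set α} (hE : MeasurableSet E) (hpE : 0 < p.real E) (hN : 0 < N) :
    Measure.pi (fun _ : Fin N => p)
      {x | ((Finset.univ.filter fun i => x i ∈ E).card : ℝ) < p.real E * N / 2} ≤
      ENNReal.ofReal (4 / (p.real E * N)) := by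
  set q := p.real E with hq
  have hN' : (0 : ℝ) < N := by exact_mod_cast hN
  set X : α → ℝ := E.indicator 1 with hX
  have hXm : Measurable X := measurable_one.indicator hE
  have hXL : MemLp X 2 p := memLp_indicator_const 2 hE 1 (Or.inr (measure_ne_top p E))
  have hXint : ∫ y, X y ∂p = q := integral_indicator_one hE
  set S : (Fin N → α) → ℝ := ∑ i, fun x => X (x i) with hS
  have hScard : ∀ x, S x = (Finset.univ.filter fun i => x i ∈ E).card := by
    intro x
    simp [hS, hX, indicator_apply]
  have hcomp : ∀ i : Fin N, MemLp (fun x : Fin N → α => X (x i)) 2 (Measure.pi fun _ => p) :=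
    fun i => hXL.comp_measurePreserving (measurePreserving_eval (fun _ : Fin N => p) i)
  have hSL : MemLp S 2 (Measure.pi fun _ : Fin N => p) := by
    rw [hS]
    exact memLp_finsetSum' _ fun i _ => hcomp i
  have hSint : ∫ x, S x ∂(Measure.pi fun _ : Fin N => p) = N * q := by
    simp only [hS, Finset.sum_apply]
    rw [integral_finsetSum _ fun i _ => (hcomp i).integrable (by norm_num)]
    have : ∀ i : Fin N, ∫ x, X (x i) ∂(Measure.pi fun _ : Fin N => p) = q := fun i => by
      rw [integral_comp_eval (μ := fun _ : Fin N => p) hXm.aestronglyMeasurable, hXint]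
    simp [this]
  have hvar : ProbabilityTheory.variance S (Measure.pi fun _ : Fin N => p) ≤ N * q := by
    have h1 : ProbabilityTheory.variance X p ≤ q := by
      have h2 := ProbabilityTheory.variance_le_sub_mul_sub (μ := p) (a := 0) (b := 1) (X := X)
        (ae_of_all _ fun y => by
          by_cases hy : y ∈ E <;> simp [hX, hy]) hXm.aemeasurable
      rw [hXint] at h2
      nlinarith [sq_nonneg q]
    rw [hS, ProbabilityTheory.variance_sum_pi fun _ => hXL]
    simpa using mul_le_mul_of_nonneg_left h1 hN'.le
  calc _ ≤ Measure.pi (fun _ : Fin N => p) {x | q * N / 2 ≤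
        |S x - ∫ x, S x ∂(Measure.pi fun _ : Fin N => p)|} := by
        refine measure_mono fun x hx => ?_
        have hx' : S x < q * N / 2 := by
          rw [hScard]
          exact hx
        change q * N / 2 ≤ |S x - _|
        rw [hSint, abs_sub_comm]
        exact le_trans (by linarith) (le_abs_self _)
    _ ≤ _ := ProbabilityTheory.meas_ge_le_variance_div_sq hSL (by positivity)
    _ ≤ _ := by
        refine ENNReal.ofReal_le_ofReal ?_
        rw [div_le_div_iff₀ (by positivity) (by positivity)]
        calc _ ≤ N * q * (q * N) := by gcongr
          _ = _ := by ring

open Classical in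
/-- Markov's inequality for the number of pairs of distinct samples in a relation `R`. -/
lemma measure_le_card_pairs_le {R : Set (α × α)} (hR : MeasurableSet R) {η t : ℝ}
    (hη : 0 ≤ η) (hRη : ∀ b, p {a | (a, b) ∈ R} ≤ ENNReal.ofReal η) (ht : 0 < t) :
    Measure.pi (fun _ : Fin N => p)
      {x | t ≤ (Finset.univ.filter fun i : Fin N × Fin N =>
        i.1 ≠ i.2 ∧ (x i.1, x i.2) ∈ R).card} ≤ ENNReal.ofReal (N ^ 2 * η / t) := by
  set Q := Finset.univ.filter fun i : Fin N × Fin N => i.1 ≠ i.2 with hQ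
  set S : (Fin N → α) → ℝ≥0∞ := fun x => ∑ i ∈ Q, R.indicator 1 (x i.1, x i.2) with hS
  have hScard : ∀ x, S x = (Finset.univ.filter fun i : Fin N × Fin N =>
      i.1 ≠ i.2 ∧ (x i.1, x i.2) ∈ R).card := by
    intro x
    simp [hS, hQ, indicator_apply, Finset.filter_filter]
  have hpair : ∀ i ∈ Q, ∫⁻ x, R.indicator (1 : α × α → ℝ≥0∞) (x i.1, x i.2)
      ∂(Measure.pi fun _ : Fin N => p) ≤ ENNReal.ofReal η := by
    intro i hi
    have hne : i.1 ≠ i.2 := (Finset.mem_filter.1 hi).2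
    have hind := (ProbabilityTheory.iIndepFun_pi (μ := fun _ : Fin N => p) (X := fun _ => id)
      fun _ => aemeasurable_id).indepFun hne
    have hmap := (ProbabilityTheory.indepFun_iff_map_prod_eq_prod_map_map
      (measurable_pi_apply _).aemeasurable (measurable_pi_apply _).aemeasurable).1 hind
    have hev : ∀ j : Fin N, Measure.map (fun x : Fin N → α => x j)
        (Measure.pi fun _ : Fin N => p) = p := fun j =>
      (measurePreserving_eval (fun _ : Fin N => p) j).map_eq
    rw [hev, hev] at hmap
    rw [← lintegral_map (μ := Measure.pi fun _ : Fin N => p) (g := fun x => (x i.1, x i.2))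
      (measurable_one.indicator hR) (by fun_prop)]
    rw [hmap, lintegral_indicator_one hR, Measure.prod_apply_symm hR]
    calc _ ≤ ∫⁻ _, ENNReal.ofReal η ∂p := lintegral_mono fun b => hRη b
      _ = _ := by simp
  have hSm : ∀ i ∈ Q, Measurable fun x : Fin N → α =>
      R.indicator (1 : α × α → ℝ≥0∞) (x i.1, x i.2) := fun i _ =>
    (measurable_one.indicator hR).comp (by fun_prop : Measurable fun x : Fin N → α => (x i.1, x i.2))
  have hSint : ∫⁻ x, S x ∂(Measure.pi fun _ : Fin N => p) ≤ ENNReal.ofReal (N ^ 2 * η) := by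
    rw [lintegral_finsetSum _ hSm]
    refine (Finset.sum_le_sum hpair).trans ?_
    rw [Finset.sum_const, nsmul_eq_mul, ← ENNReal.ofReal_natCast, ← ENNReal.ofReal_mul (by simp)]
    refine ENNReal.ofReal_le_ofReal (mul_le_mul_of_nonneg_right ?_ hη)
    have : Q.card ≤ N * N := by
      simpa using Finset.card_le_univ Q
    rw [sq]
    exact_mod_cast this
  have ht' : ENNReal.ofReal t ≠ 0 := (ENNReal.ofReal_pos.2 ht).ne'
  calc _ ≤ Measure.pi (fun _ : Fin N => p) {x | ENNReal.ofReal t ≤ S x} := by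
        refine measure_mono fun x hx => ?_
        change _ ≤ S x
        rw [hScard, ← ENNReal.ofReal_natCast]
        exact ENNReal.ofReal_le_ofReal hx
    _ ≤ (∫⁻ x, S x ∂(Measure.pi fun _ : Fin N => p)) / ENNReal.ofReal t :=
        meas_ge_le_lintegral_div (Finset.measurable_fun_sum _ hSm).aemeasurable ht'
          ENNReal.ofReal_ne_top
    _ ≤ ENNReal.ofReal (N ^ 2 * η) / ENNReal.ofReal t := by gcongr
    _ = _ := (ENNReal.ofReal_div_of_pos ht).symm

end Sampling

/-! ### Random data -/

section RandomData

variable {n m N : ℕ}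

/-- A lower bound for the length of the path through the labels bounds the ratio in the theorem even
where the diameter could vanish: then all labels would coincide. -/
lemma div_le_tsp_div_diam (f : EuclideanSpace ℝ (Fin n) → EuclideanSpace ℝ (Fin m))
    {x : Fin N → EuclideanSpace ℝ (Fin n)} {t D : ℝ} (ht : 0 < t)
    (htsp : t ≤ tsp fun i => f (x i)) (hD : Metric.diam (range x) ≤ D) :
    t / D ≤ tsp (fun i => f (x i)) / Metric.diam (range x) := by
  have hpos : 0 < Metric.diam (range x) := by
    refine lt_of_le_of_ne Metric.diam_nonneg fun h0 => ?_
    have hall : ∀ i j, x i = x j := fun i j => dist_le_zero.1 <| h0 ▸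
      Metric.dist_le_diam_of_mem (finite_range x).isBounded (mem_range_self i) (mem_range_self j)
    have := tsp_eq_zero_of_forall_eq (y := fun i => f (x i)) fun i j => by rw [hall i j]
    linarith
  have htsp0 := ht.le.trans htsp
  gcongr

open Classical in
/-- The consequences of having few close pairs among the samples. Since `Ω` need not be convex, the
bound for the representation cost is obtained from the samples in `E` alone. -/
lemma bounds_of_few_close_pairs {f : EuclideanSpace ℝ (Fin n) → EuclideanSpace ℝ (Fin m)}
    {x : Fin N → EuclideanSpace ℝ (Fin n)} {E Ω : Set (EuclideanSpace ℝ (Fin n))}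
    (hE : convexHull ℝ E ⊆ Ω) {r t D : ℝ} (hr : 0 ≤ r) (ht : 0 < t)
    (hcard : t ≤ r * ((Finset.univ.filter fun i => x i ∈ E).card - 1 -
      (Finset.univ.filter fun i : Fin N × Fin N =>
        i.1 ≠ i.2 ∧ x i.1 ∈ E ∧ dist (f (x i.1)) (f (x i.2)) < r).card))
    (hD : Metric.diam (range x) ≤ D) :
    t / D ≤ tsp (fun i => f (x i)) / Metric.diam (range x) ∧
    ∀ fhat : EuclideanSpace ℝ (Fin n) → EuclideanSpace ℝ (Fin m),
      rankBN fhat Ω = 1 → (∀ i, fhat (x i) = f (x i)) → ∀ (L : ℕ) (a : ℝ), 1 ≤ L → -1 < a → a < 1 →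
        ENNReal.ofReal ((t / D) ^ (2 / (L : ℝ))) ≤ reprCost fhat Ω (sigmaA a) L / (L : ℝ≥0∞) := by
  set G := Finset.univ.filter fun i => x i ∈ E with hG
  set P := Finset.univ.filter fun i : Fin N × Fin N =>
        i.1 ≠ i.2 ∧ x i.1 ∈ E ∧ dist (f (x i.1)) (f (x i.2)) < r with hP
  have hD0 : 0 ≤ D := Metric.diam_nonneg.trans hD
  refine ⟨div_le_tsp_div_diam f ht (hcard.trans ?_) hD, ?_⟩
  · have := mul_card_sub_le_tsp (fun i => f (x i)) G hr
    simpa [hG, hP] using this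
  intro fhat hrank hint L a hL ha ha'
  let e := G.orderEmbOfFin rfl
  have he : ∀ i, x (e i) ∈ E := fun i =>
    (Finset.mem_filter.1 (G.orderEmbOfFin_mem rfl i)).2
  have hG1 : 1 ≤ G.card := by
    by_contra! h0
    have h1 : (G.card : ℝ) = 0 := by exact_mod_cast Nat.lt_one_iff.1 h0
    have h2 : (0 : ℝ) ≤ P.card := by positivity
    rw [h1] at hcard
    nlinarith
  have htsp : t ≤ tsp fun i => f (x (e i)) := by
    refine hcard.trans (le_trans ?_
      (mul_card_sub_le_tsp (fun i => f (x (e i))) Finset.univ hr))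
    refine mul_le_mul_of_nonneg_left ?_ hr
    rw [Finset.card_univ, Fintype.card_fin]
    refine sub_le_sub_left (Nat.cast_le.2 ?_) _
    refine Finset.card_le_card_of_injOn (Prod.map e e) (fun i hi => ?_)
      (e.injective.prodMap e.injective).injOn
    simp only [Finset.coe_filter, Finset.mem_univ, true_and, mem_ofPred_eq] at hi
    simp only [hP, Finset.coe_filter, Finset.mem_univ, true_and, mem_ofPred_eq, Prod.map_fst,
      Prod.map_snd]
    exact ⟨e.injective.ne hi.1, he _, hi.2⟩
  have hsub : range (fun i => x (e i)) ⊆ range x := range_comp_subset_range e x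
  have hratio := div_le_tsp_div_diam f ht htsp
    ((Metric.diam_mono hsub (finite_range x).isBounded).trans hD)
  have hcost := ofReal_tsp_div_diam_rpow_le_reprCost (x := fun i => x (e i)) hrank hG1
    ((convexHull_mono (range_subset_iff.2 he)).trans hE) hL ha ha'
  simp only [hint] at hcost
  refine le_trans (ENNReal.ofReal_le_ofReal ?_) hcost
  gcongr

/-- A constant that works for all depths at once: `min 1 (C ^ 2)` is at most `C ^ (2 / L)`. -/
lemma min_one_sq_mul_rpow_lt {C s : ℝ} (hC : 0 < C) {T γ : ℝ} (hT : 0 ≤ T) (h : C * T ^ γ < s)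
    {L : ℕ} (hL : 1 ≤ L) : min 1 (C ^ 2) * T ^ (2 / (L : ℝ) * γ) < s ^ (2 / (L : ℝ)) := by
  have hL1 : (1 : ℝ) ≤ L := by exact_mod_cast hL
  have hpos : (0 : ℝ) < 2 / L := by positivity
  have h2 : (2 : ℝ) / L ≤ 2 := div_le_self (by norm_num) hL1
  have hmin : min 1 (C ^ 2) ≤ C ^ (2 / (L : ℝ)) := by
    rcases le_total 1 C with h1 | h1
    · exact (min_le_left _ _).trans (Real.one_le_rpow h1 hpos.le)
    · refine (min_le_right _ _).trans ?_
      rw [← Real.rpow_natCast]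
      exact Real.rpow_le_rpow_of_exponent_ge hC h1 (by exact_mod_cast h2)
  calc _ ≤ C ^ (2 / (L : ℝ)) * T ^ (2 / (L : ℝ) * γ) := by gcongr
    _ = (C * T ^ γ) ^ (2 / (L : ℝ)) := by
        rw [Real.mul_rpow hC.le (by positivity), ← Real.rpow_mul hT, mul_comm γ]
    _ < _ := Real.rpow_lt_rpow (by positivity) h hpos

open Classical in
/-- The bounds for random data, for all depths and all interpolating functions on one event of
probability at least `1 - ε`. -/
theorem exists_random_data_bound {Ω : Set (EuclideanSpace ℝ (Fin n))}
    {f : EuclideanSpace ℝ (Fin n) → EuclideanSpace ℝ (Fin m)}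
    {p : Measure (EuclideanSpace ℝ (Fin n))} [IsProbabilityMeasure p]
    (hbdd : Bornology.IsBounded Ω) (hΩ : Ω ⊆ closure (interior Ω))
    (hf : IsFPLF f) (hk : 1 ≤ rankJ f Ω) (hp : p Ωᶜ = 0) (hsupp : p.support = closure Ω)
    (hsing : ∀ U : Set (EuclideanSpace ℝ (Fin n)), IsOpen U → p U ≠ 0 →
      ¬ Measure.MutuallySingular (p.restrict U) volume) {ε : ℝ} (hε : 0 < ε) :
    ∃ c : ℝ, 0 < c ∧ ∃ N₀ : ℕ, ∀ N : ℕ, N₀ ≤ N →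
      Measure.pi (fun _ : Fin N => p)
        {x | ¬ ∀ (L : ℕ) (a : ℝ), 1 ≤ L → -1 < a → a < 1 →
          c * (N : ℝ) ^ (2 / (L : ℝ) * (1 - 1 / (rankJ f Ω : ℝ)))
            < (tsp (fun i => f (x i)) / Metric.diam (range x)) ^ (2 / (L : ℝ)) ∧
          ∀ fhat : EuclideanSpace ℝ (Fin n) → EuclideanSpace ℝ (Fin m),
            rankBN fhat Ω = 1 → (∀ i, fhat (x i) = f (x i)) →
              ENNReal.ofReal (c * (N : ℝ) ^ (2 / (L : ℝ) * (1 - 1 / (rankJ f Ω : ℝ))))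
                < reprCost fhat Ω (sigmaA a) L / (L : ℝ≥0∞)}
        ≤ ENNReal.ofReal ε := by
  obtain ⟨E, hE, hconv, hpE, C, hC, hball⟩ := hf.exists_small_ball hΩ hk hsupp hsing
  have hfc := hf.isPiecewiseAffine.continuous
  set k := rankJ f Ω
  have hk0 : (k : ℝ) ≠ 0 := by positivity
  set q := p.real E with hq
  have hq0 : 0 < q := ENNReal.toReal_pos hpE (measure_ne_top p E)
  -- With `r = δ * N ^ (-1 / k)` the expected number of close pairs is at most `ε / 2` times
  -- `q * N / 4`.
  set δ := (q * ε / (8 * C)) ^ (1 / (k : ℝ)) with hδ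
  have hδ0 : 0 < δ := by positivity
  have hδk : δ ^ k = q * ε / (8 * C) := by
    rw [hδ, ← Real.rpow_natCast, ← Real.rpow_mul (by positivity), one_div_mul_cancel hk0,
      Real.rpow_one]
  set D := Metric.diam Ω + 1 with hDdef
  have hD0 : 0 < D := by have : 0 ≤ Metric.diam Ω := Metric.diam_nonneg; positivity
  set C₀ := δ * q / (8 * D) / 2 with hC₀
  have hC₀0 : 0 < C₀ := by positivity
  refine ⟨min 1 (C₀ ^ 2), by positivity, ⌈8 / (q * ε) + 8 / q⌉₊ + 1, fun N hN => ?_⟩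
  have hN0 : 0 < N := by omega
  have hNR : (0 : ℝ) < N := by exact_mod_cast hN0
  have hNle : 8 / (q * ε) + 8 / q ≤ N :=
    (Nat.le_ceil _).trans (by exact_mod_cast (Nat.le_succ _).trans hN)
  have hN1 : 8 / (q * ε) ≤ N := le_trans (le_add_of_nonneg_right (by positivity)) hNle
  have hN2 : 8 / q ≤ N := le_trans (le_add_of_nonneg_left (by positivity)) hNle
  rw [div_le_iff₀ (by positivity)] at hN1 hN2
  set r := δ * (N : ℝ) ^ (-(1 / (k : ℝ))) with hr
  have hr0 : 0 < r := by positivity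
  have hrk : C * r ^ k = q * ε / (8 * N) := by
    rw [hr, mul_pow, hδk, ← Real.rpow_natCast, ← Real.rpow_mul hNR.le, neg_mul,
      one_div_mul_cancel hk0, Real.rpow_neg_one]
    field_simp
  set t := r * (q * N / 8) with ht
  have ht0 : 0 < t := by positivity
  have htD : C₀ * (N : ℝ) ^ (1 - 1 / (k : ℝ)) < t / D := by
    have h1 : (N : ℝ) ^ (1 - 1 / (k : ℝ)) = N ^ (-(1 / (k : ℝ))) * N := by
      rw [sub_eq_neg_add, Real.rpow_add hNR, Real.rpow_one]
    have h2 : C₀ * (N : ℝ) ^ (1 - 1 / (k : ℝ)) = t / D / 2 := by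
      rw [h1, hC₀, ht, hr]
      field_simp
    rw [h2]
    exact half_lt_self (by positivity)
  obtain ⟨R, hR⟩ : ∃ R : Set (EuclideanSpace ℝ (Fin n) × EuclideanSpace ℝ (Fin n)),
    R = {b | b.1 ∈ E ∧ dist (f b.1) (f b.2) < r} := ⟨_, rfl⟩
  have hRm : MeasurableSet R := hR ▸ (measurable_fst hE).inter
    (measurableSet_lt (f := fun b : EuclideanSpace ℝ (Fin n) × EuclideanSpace ℝ (Fin n) =>
      dist (f b.1) (f b.2)) (by fun_prop) measurable_const)
  have hfew := measure_card_mem_lt_le (p := p) hE hq0 hN0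
  have hpairs := measure_le_card_pairs_le (p := p) (N := N) hRm
    (η := C * r ^ k) (t := q * N / 4) (by positivity) (fun b => hR ▸ hball (f b) r hr0.le)
    (by positivity)
  have hout : Measure.pi (fun _ : Fin N => p) {x | ¬ ∀ i, x i ∈ Ω} = 0 := by
    rw [← ae_iff, ae_all_iff]
    exact fun i => Measure.tendsto_eval_ae_ae.eventually (mem_ae_iff.2 hp)
  calc _ ≤ Measure.pi (fun _ : Fin N => p)
        (({x | ((Finset.univ.filter fun i => x i ∈ E).card : ℝ) < q * N / 2} ∪
          {x | q * N / 4 ≤ (Finset.univ.filter fun i : Fin N × Fin N =>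
            i.1 ≠ i.2 ∧ (x i.1, x i.2) ∈ R).card}) ∪ {x | ¬ ∀ i, x i ∈ Ω}) := by
        refine measure_mono fun x hx => ?_
        by_contra hgood
        refine hx ?_
        simp only [mem_union, not_or, mem_ofPred_eq, not_lt, not_le, not_not] at hgood
        obtain ⟨⟨hx1, hx2⟩, hx3⟩ := hgood
        have hdiam : Metric.diam (range x) ≤ D :=
          (Metric.diam_mono (range_subset_iff.2 hx3) hbdd).trans (by linarith)
        obtain ⟨hb1, hb2⟩ := bounds_of_few_close_pairs (f := f) (x := x) hconv hr0.le ht0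
          (mul_le_mul_of_nonneg_left (by
            simp only [hR, mem_ofPred_eq] at hx2
            linarith) hr0.le) hdiam
        intro L a hL ha ha'
        have hlt := min_one_sq_mul_rpow_lt hC₀0 hNR.le htD hL
        refine ⟨hlt.trans_le (Real.rpow_le_rpow (by positivity) hb1 (by positivity)),
          fun fhat hrank hint => lt_of_lt_of_le ?_ (hb2 fhat hrank hint L a hL ha ha')⟩
        exact (ENNReal.ofReal_lt_ofReal_iff (by positivity)).2 hlt
    _ ≤ ENNReal.ofReal (ε / 2) + ENNReal.ofReal (ε / 2) + 0 := by
        refine (measure_union_le _ _).trans (add_le_add ((measure_union_le _ _).trans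
          (add_le_add (hfew.trans (ENNReal.ofReal_le_ofReal ?_))
            (hpairs.trans (ENNReal.ofReal_le_ofReal ?_)))) hout.le)
        · rw [div_le_iff₀ (by positivity)]
          linarith
        · rw [hrk]
          refine le_of_eq ?_
          field_simp
          norm_num
    _ = ENNReal.ofReal ε := by
        rw [add_zero, ← ENNReal.ofReal_add (by positivity) (by positivity), add_halves]

end RandomData

theorem theorem2 (n m : ℕ) :
    -- Interpolation of finitely many points by a function of bottleneck rank one.
    (∀ (Ω : Set (EuclideanSpace ℝ (Fin n)))
        (f : EuclideanSpace ℝ (Fin n) → EuclideanSpace ℝ (Fin m)) (N : ℕ)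
        (x : Fin N → EuclideanSpace ℝ (Fin n)) (y : Fin N → EuclideanSpace ℝ (Fin m)),
        1 ≤ N → convexHull ℝ (range x) ⊆ Ω → rankBN f Ω = 1 → (∀ i, f (x i) = y i) →
        -- A point with a large Jacobian.
        (Ω ⊆ closure (interior Ω) →
          ∃ z ∈ Ω, DifferentiableAt ℝ f z ∧
            tsp y / Metric.diam (range x) ≤ ‖fderiv ℝ f z‖) ∧
        -- The parameter norm and the representation cost.
        (∀ (L : ℕ) (a : ℝ), 1 ≤ L → -1 < a → a < 1 →
          (∀ w : Network L n m, EqOn (w.eval (sigmaA a)) f Ω →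
            (L : ℝ) * (tsp y / Metric.diam (range x)) ^ (2 / (L : ℝ)) ≤ w.normSq) ∧
          ENNReal.ofReal ((tsp y / Metric.diam (range x)) ^ (2 / (L : ℝ)))
            ≤ reprCost f Ω (sigmaA a) L / (L : ℝ≥0∞))) ∧
    -- Random data labelled by a true function of Jacobian rank `k`.
    (∀ (Ω : Set (EuclideanSpace ℝ (Fin n)))
        (fstar : EuclideanSpace ℝ (Fin n) → EuclideanSpace ℝ (Fin m)) (k : ℕ)
        (p : Measure (EuclideanSpace ℝ (Fin n))) [IsProbabilityMeasure p],
        Bornology.IsBounded Ω → Ω ⊆ closure (interior Ω) →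
        IsFPLF fstar → rankJ fstar Ω = k → 1 ≤ k →
        p Ωᶜ = 0 → p.support = closure Ω →
        (∀ U : Set (EuclideanSpace ℝ (Fin n)), IsOpen U → p U ≠ 0 →
          ¬ Measure.MutuallySingular (p.restrict U) volume) →
        ∀ ε : ℝ, 0 < ε → ∃ c : ℝ, 0 < c ∧ ∃ N₀ : ℕ, ∀ N : ℕ, N₀ ≤ N →
          Measure.pi (fun _ : Fin N => p)
            {x | ¬ ∀ (L : ℕ) (a : ℝ), 1 ≤ L → -1 < a → a < 1 →
              c * (N : ℝ) ^ (2 / (L : ℝ) * (1 - 1 / (k : ℝ)))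
                < (tsp (fun i => fstar (x i)) / Metric.diam (range x)) ^ (2 / (L : ℝ)) ∧
              ∀ fhat : EuclideanSpace ℝ (Fin n) → EuclideanSpace ℝ (Fin m),
                rankBN fhat Ω = 1 → (∀ i, fhat (x i) = fstar (x i)) →
                  ENNReal.ofReal (c * (N : ℝ) ^ (2 / (L : ℝ) * (1 - 1 / (k : ℝ))))
                    < reprCost fhat Ω (sigmaA a) L / (L : ℝ≥0∞)}
            ≤ ENNReal.ofReal ε) := by
  refine ⟨fun Ω f N x y hN hx hrank hy => ?_,
    fun Ω fstar k p _ hbdd hΩ hf hrank hk hp hsupp hsing ε hε => ?_⟩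
  · obtain rfl : (fun i => f (x i)) = y := funext hy
    exact ⟨exists_tsp_div_diam_le_norm_fderiv hrank hN hx, fun L a hL ha ha' =>
      ⟨fun w hw => mul_tsp_div_diam_rpow_le_normSq hrank hN hx hL ha ha' hw,
        ofReal_tsp_div_diam_rpow_le_reprCost hrank hN hx hL ha ha'⟩⟩
  · subst hrank
    exact exists_random_data_bound hbdd hΩ hf hk hp hsupp hsing hε
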